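/- Let $n\ge 2$ and $k\ge 3$ be integers, and let $H_1,\dots,H_k$ be linear subspaces of $\mathbb{R}^n$, all of dimension $i$. For a subspace $H$ let $R_H$ be the reflection in $H$, i.e. $R_Hx=2(x|H)-x$, where $x|H$ is the orthogonal projection of $x$ on $H$. For an integer $p$ with $2\le p\le n/2$, say that $p$-dimensional subspaces $L_1,\dots,L_k$ of $\mathbb{R}^n$ satisfy condition $(\ast)_p$ if (i) there are an orthonormal basis $e_1,\dots,e_n$ of $\mathbb{R}^n$ and an increasing sequence $\alpha_1,\dots,\alpha_p$ in $(0,\pi/2)$ such that $\pi,\alpha_1,\dots,\alpha_p$ are linearly independent over $\mathbb{Q}$ and $$L_1=\operatorname{lin}\{e_1,e_3,\dots,e_{2p-1}\},\qquad L_2=\operatorname{lin}\{\cos\alpha_j\,e_{2j-1}+\sin\alpha_j\,e_{2j}: j=1,\dots,p\},$$ $$L_3=\operatorname{lin}\bigl(\{\cos\alpha_1\,e_1+\sin\alpha_1\,e_{2p}\}\cup\{\cos\alpha_j\,e_{2j-1}+\sin\alpha_j\,e_{2j-2}: j=2,\dots,p\}\bigr);$$ (ii) $L_1+\cdots+L_k=\mathbb{R}^n$;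 and (iii) $L_{j+1}\cap(L_1+\cdots+L_j)^\perp=\{o\}$ for each $j=3,\dots,k-1$. Suppose that either $2\le i\le n/2$ and $H_1,\dots,H_k$ satisfy $(\ast)_i$, or $n/2<i\le n-2$ and $H_1^\perp,\dots,H_k^\perp$ satisfy $(\ast)_{n-i}$. If $E\subset S^{n-1}$ is nonempty, closed, and such that $R_{H_j}E=E$ for $j=1,\dots,k$, then $E=S^{n-1}$. -/

import Mathlib

/-- The index `2j-1` (numbering from `1`) of the vector `e_{2j-1}`; as a number from `0` it is `2j`
for `j` counted from `0`. -/
def oddIdx {p : ℕ} (j : Fin p) : Fin (2 * p) :=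
  ⟨2 * (j : ℕ), by have := j.isLt; omega⟩

/-- The index `2j` (numbering from `1`) that is paired with `2j-1` in the second subspace. -/
def nextIdx {p : ℕ} (j : Fin p) : Fin (2 * p) :=
  ⟨2 * (j : ℕ) + 1, by have := j.isLt; omega⟩

/-- The index that is paired with `2j-1` in the third subspace: `2j-2` for `j ≥ 2` and `2p` for
`j = 1` (numbering from `1`). -/
def prevIdx {p : ℕ} (j : Fin p) : Fin (2 * p) :=
  if (j : ℕ) = 0 then ⟨2 * p - 1, by have := j.isLt; omega⟩
  else ⟨2 * (j : ℕ) - 1, by have := j.isLt; omega⟩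

/-- `H₁, H₂, H₃` are the three `p`-dimensional subspaces of `ℝⁿ`
`lin {e₁, e₃, …, e_{2p-1}}`,
`lin {cos α_j e_{2j-1} + sin α_j e_{2j} : j = 1, …, p}` and
`lin ({cos α₁ e₁ + sin α₁ e_{2p}} ∪ {cos α_j e_{2j-1} + sin α_j e_{2j-2} : j = 2, …, p})`
for an orthonormal basis `e₁, …, eₙ` and increasing angles `α₁, …, α_p` in `(0, π/2)` such that
`π, α₁, …, α_p` are linearly independent over `ℚ`. -/
def IsRotatedTriple {n : ℕ} (p : ℕ) (H₁ H₂ H₃ : Submodule ℝ (EuclideanSpace ℝ (Fin n))) : Prop :=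
  ∃ (hp : 2 * p ≤ n) (e : OrthonormalBasis (Fin n) ℝ (EuclideanSpace ℝ (Fin n))) (α : Fin p → ℝ),
    Monotone α ∧ (∀ j, α j ∈ Set.Ioo 0 (Real.pi / 2)) ∧
    LinearIndependent ℚ (Fin.cons Real.pi α : Fin (p + 1) → ℝ) ∧
    H₁ = Submodule.span ℝ (Set.range fun j : Fin p => e (Fin.castLE hp (oddIdx j))) ∧
    H₂ = Submodule.span ℝ (Set.range fun j : Fin p =>
      Real.cos (α j) • e (Fin.castLE hp (oddIdx j)) +
        Real.sin (α j) • e (Fin.castLE hp (nextIdx j))) ∧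
    H₃ = Submodule.span ℝ (Set.range fun j : Fin p =>
      Real.cos (α j) • e (Fin.castLE hp (oddIdx j)) +
        Real.sin (α j) • e (Fin.castLE hp (prevIdx j)))

/-- The three conditions on a family of `p`-dimensional subspaces `H 0, …, H (k - 1)` of `ℝⁿ`:
the first three form a rotated triple, they all sum to `ℝⁿ`, and each subspace from the fourth on
meets the orthogonal complement of the sum of the preceding ones only in the origin. -/
structure ReflectionConditions {n k : ℕ} (hk : 3 ≤ k) (p : ℕ)
    (H : Fin k → Submodule ℝ (EuclideanSpace ℝ (Fin n))) : Prop where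
  triple : IsRotatedTriple p (H ⟨0, by omega⟩) (H ⟨1, by omega⟩) (H ⟨2, by omega⟩)
  sum_eq_top : ⨆ j, H j = ⊤
  inf_orthogonal : ∀ m : Fin k, 3 ≤ (m : ℕ) → H m ⊓ (⨆ l : Fin k, ⨆ _ : l < m, H l)ᗮ = ⊥

open Filter Topology
open scoped RealInnerProductSpace

/-! Call `E` saturated along `V` if from each of its points it contains the whole sphere cut out of
the translate of `V` by the norm (`SaturatedAlong`). The aim is saturation along the whole space.
The product of the reflections in the first two subspaces rotates `p` orthogonal planes by the
angles `2 * α j`. By Kronecker's theorem its powers are dense in the torus of all such rotations, so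
the closed set `E` is saturated along each plane separately (`saturatedAlong_span_pair`). The first
and third subspaces give a second family of planes, interlocking with the first. Saturation along
two subspaces with a common line passes to their sum (`SaturatedAlong.sup`). This joins the planes
along the chain of basis vectors. A further subspace `L` is added by reflecting: `E` is also
saturated along the image of `V` under the reflection in `L`. For dimension reasons this image meets
`V`, and its sum with `V` contains `L` if `L ⊓ Vᗮ = ⊥` (`SaturatedAlong.sup_of_reflection`). The
reflection in `Hᗮ` is minus that in `H`. A sign `ε = ±1` carried through the argument treats both
ranges of the dimension together. -/

/-! ### Kronecker's theorem by averaging over an orbit. -/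

theorem UnitAddTorus.mFourier_add_apply {d : Type*} [Fintype d] (n : d → ℤ) (x y : UnitAddTorus d) :
    UnitAddTorus.mFourier n (x + y) = UnitAddTorus.mFourier n x * UnitAddTorus.mFourier n y := by
  simp only [mFourier, ContinuousMap.coe_mk, Pi.add_apply, fourier_apply, smul_add,
    AddCircle.toCircle_add, Circle.coe_mul, Finset.prod_mul_distrib]

theorem UnitAddTorus.mFourier_nsmul_apply {d : Type*} [Fintype d] (n : d → ℤ) (m : ℕ)
    (x : UnitAddTorus d) :
    UnitAddTorus.mFourier n (m • x) = UnitAddTorus.mFourier n x ^ m := by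
  induction m with
  | zero => simp [mFourier]
  | succ k ih => rw [succ_nsmul, mFourier_add_apply, ih, pow_succ]

/-- The difference of the averages of `f` along the orbit of `g` and along its translate by `y`. -/
noncomputable def averageDiff {G : Type*} [AddCommGroup G] (g y : G) (f : G → ℂ) (N : ℕ) : ℂ :=
  (N : ℂ)⁻¹ * ∑ m ∈ Finset.range N, (f (m • g) - f (m • g + y))

theorem norm_averageDiff_le {G : Type*} [AddCommGroup G] (g y : G) (f : G → ℂ) {C : ℝ}
    (hC : 0 ≤ C) (hf : ∀ x, ‖f x‖ ≤ C) (N : ℕ) : ‖averageDiff g y f N‖ ≤ 2 * C := by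
  rcases Nat.eq_zero_or_pos N with rfl | hN
  · simp [averageDiff, hC]
  · have hN' : (0 : ℝ) < N := by exact_mod_cast hN
    have h : ‖∑ m ∈ Finset.range N, (f (m • g) - f (m • g + y))‖ ≤ N * (2 * C) := by
      refine (norm_sum_le _ _).trans ?_
      refine (Finset.sum_le_card_nsmul _ _ (2 * C) fun m _ => ?_).trans (by simp)
      linarith [norm_sub_le (f (m • g)) (f (m • g + y)), hf (m • g), hf (m • g + y)]
    rw [averageDiff, norm_mul, norm_inv, Complex.norm_natCast, inv_mul_le_iff₀ hN']
    exact h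

/-- The trivial character is translation invariant; for any other one the sum is a geometric sum,
bounded in `N`. -/
theorem tendsto_averageDiff_mFourier {d : Type*} [Fintype d] (g y : UnitAddTorus d) (n : d → ℤ)
    (hn : n ≠ 0 → UnitAddTorus.mFourier n g ≠ 1) :
    Tendsto (averageDiff g y (UnitAddTorus.mFourier n)) atTop (𝓝 0) := by
  by_cases h0 : n = 0
  · have : averageDiff g y (UnitAddTorus.mFourier n) = fun _ => 0 := by
      funext N
      simp [averageDiff, h0, UnitAddTorus.mFourier_zero]
    rw [this]
    exact tendsto_const_nhds
  have hz := hn h0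
  set z := UnitAddTorus.mFourier n g with hzdef
  set w := UnitAddTorus.mFourier n y
  have hnorm : ∀ x, ‖UnitAddTorus.mFourier n x‖ ≤ 1 := fun x =>
    ((UnitAddTorus.mFourier n).norm_coe_le_norm x).trans_eq UnitAddTorus.mFourier_norm
  have hform : averageDiff g y (UnitAddTorus.mFourier n) =
      fun N : ℕ => (N : ℂ)⁻¹ * ((1 - w) * ((z ^ N - 1) / (z - 1))) := by
    funext N
    rw [averageDiff, ← geom_sum_eq hz, Finset.mul_sum, Finset.mul_sum, Finset.mul_sum]
    refine Finset.sum_congr rfl fun m _ => ?_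
    rw [UnitAddTorus.mFourier_add_apply, UnitAddTorus.mFourier_nsmul_apply,
      ← hzdef]
    ring
  rw [hform]
  refine squeeze_zero_norm (a := fun N : ℕ => (N : ℝ)⁻¹ * (‖1 - w‖ * (2 / ‖z - 1‖))) ?_ ?_
  · intro N
    rw [norm_mul, norm_inv, Complex.norm_natCast, norm_mul, norm_div]
    gcongr
    refine (norm_sub_le _ _).trans ?_
    rw [norm_pow, norm_one]
    linarith [pow_le_one₀ (norm_nonneg z) (hnorm g) (n := N)]
  · simpa using tendsto_inv_atTop_nhds_zero_nat.mul_const (‖1 - w‖ * (2 / ‖z - 1‖))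

/-- Trigonometric polynomials are uniformly dense, and `averageDiff` is bounded by twice the sup
norm uniformly in `N`. -/
theorem tendsto_averageDiff {d : Type*} [Fintype d] (g y : UnitAddTorus d)
    (hg : ∀ n : d → ℤ, n ≠ 0 → UnitAddTorus.mFourier n g ≠ 1) (f : C(UnitAddTorus d, ℂ)) :
    Tendsto (averageDiff g y f) atTop (𝓝 0) := by
  have hspan : ∀ q ∈ Submodule.span ℂ (Set.range (UnitAddTorus.mFourier (d := d))),
      Tendsto (averageDiff g y q) atTop (𝓝 0) := by
    intro q hq
    induction hq using Submodule.span_induction with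
    | mem q hq =>
      obtain ⟨n, rfl⟩ := hq
      exact tendsto_averageDiff_mFourier g y n (hg n)
    | zero =>
      have : averageDiff g y ((0 : C(UnitAddTorus d, ℂ)) : UnitAddTorus d → ℂ) = fun _ => 0 := by
        funext N; simp [averageDiff]
      rw [this]; exact tendsto_const_nhds
    | add p q _ _ hp hq =>
      have : averageDiff g y ((p + q : C(UnitAddTorus d, ℂ)) : UnitAddTorus d → ℂ) =
          fun N => averageDiff g y p N + averageDiff g y q N := by
        funext N
        simp only [averageDiff, ContinuousMap.add_apply, ← mul_add, ← Finset.sum_add_distrib]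
        congr 1
        exact Finset.sum_congr rfl fun m _ => by ring
      rw [this]; simpa using hp.add hq
    | smul c p _ hp =>
      have : averageDiff g y ((c • p : C(UnitAddTorus d, ℂ)) : UnitAddTorus d → ℂ) =
          fun N => c * averageDiff g y p N := by
        funext N
        simp only [averageDiff, ContinuousMap.smul_apply, smul_eq_mul, Finset.mul_sum]
        exact Finset.sum_congr rfl fun m _ => by ring
      rw [this]; simpa using hp.const_mul c
  have hf : f ∈
      (Submodule.span ℂ (Set.range (UnitAddTorus.mFourier (d := d)))).topologicalClosure := by
    rw [UnitAddTorus.span_mFourier_closure_eq_top]; trivial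
  rw [Metric.tendsto_atTop]
  intro ε hε
  obtain ⟨q, hq, hqf⟩ := Metric.mem_closure_iff.1 hf (ε / 4) (by positivity)
  obtain ⟨N₀, hN₀⟩ := Metric.tendsto_atTop.1 (hspan q hq) (ε / 2) (by positivity)
  refine ⟨N₀, fun N hN => ?_⟩
  have h1 := hN₀ N hN
  have h2 := norm_averageDiff_le g y (fun x => f x - q x) (norm_nonneg (f - q))
    (fun x => (f - q).norm_coe_le_norm x) N
  have h3 : averageDiff g y (fun x => f x - q x) N = averageDiff g y f N - averageDiff g y q N := by
    simp only [averageDiff, ← mul_sub, ← Finset.sum_sub_distrib]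
    congr 1
    exact Finset.sum_congr rfl fun m _ => by ring
  rw [dist_eq_norm] at hqf
  rw [dist_zero_right] at h1 ⊢
  rw [h3] at h2
  have h4 := norm_sub_norm_le (averageDiff g y f N) (averageDiff g y q N)
  linarith

/-- Kronecker's theorem: the multiples of a point of the torus at which no nontrivial character
takes the value `1` are dense. -/
theorem UnitAddTorus.exists_nsmul_norm_sub_lt {d : Type*} [Fintype d] (g : UnitAddTorus d)
    (hg : ∀ n : d → ℤ, n ≠ 0 → UnitAddTorus.mFourier n g ≠ 1) (y : UnitAddTorus d) {ε : ℝ}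
    (hε : 0 < ε) : ∃ m : ℕ, ‖m • g - y‖ < ε := by
  by_contra! hfar
  -- A bump at `y` would vanish on the orbit, so the orbit averages of all its translates tend to
  -- `0`. But finitely many translates have a sum that is at least `ε / 2` everywhere.
  let f : UnitAddTorus d → ℝ := fun x => max 0 (ε - ‖x‖)
  have hfc : Continuous f := by fun_prop
  have hf0 : ∀ x, 0 ≤ f x := fun x => le_max_left _ _
  let h : C(UnitAddTorus d, ℂ) := ⟨fun x => (f (x - y) : ℂ), by fun_prop⟩
  have hzero : ∀ m : ℕ, h (m • g) = 0 := fun m => by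
    have : f (m • g - y) = 0 := max_eq_left (by linarith [hfar m])
    simp [h, this]
  obtain ⟨t, -, ht⟩ := (isCompact_univ (X := UnitAddTorus d)).elim_nhds_subcover
    (fun c => Metric.ball c (ε / 2)) fun c _ => Metric.ball_mem_nhds c (by positivity)
  have hlim : Tendsto (fun N => ∑ c ∈ t, averageDiff g (y - c) h N) atTop (𝓝 0) := by
    simpa using tendsto_finsetSum t fun c _ => tendsto_averageDiff g (y - c) hg h
  have hshift : ∀ a c, h (a + (y - c)) = (f (a - c) : ℂ) := fun a c => by
    have hac : a + (y - c) - y = a - c := by abel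
    change (f (a + (y - c) - y) : ℂ) = _
    rw [hac]
  have hval : ∀ N, ∑ c ∈ t, averageDiff g (y - c) h N =
      ((-((N : ℝ)⁻¹ * ∑ m ∈ Finset.range N, ∑ c ∈ t, f (m • g - c)) : ℝ) : ℂ) := by
    intro N
    simp only [averageDiff, hzero, hshift, zero_sub, Finset.sum_neg_distrib, mul_neg]
    rw [Finset.sum_comm (s := Finset.range N), ← Finset.mul_sum]
    push_cast
    rfl
  have hlow : ∀ x, ε / 2 ≤ ∑ c ∈ t, f (x - c) := by
    intro x
    obtain ⟨c, hc, hxc⟩ := Set.mem_iUnion₂.1 (ht (Set.mem_univ x))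
    refine le_trans ?_ (Finset.single_le_sum (fun c _ => hf0 (x - c)) hc)
    refine le_trans ?_ (le_max_right _ _)
    rw [Metric.mem_ball, dist_eq_norm] at hxc
    linarith
  obtain ⟨N₀, hN₀⟩ := Metric.tendsto_atTop.1 hlim (ε / 2) (by positivity)
  have h1 := hN₀ (N₀ + 1) (by omega)
  rw [hval, dist_zero_right, Complex.norm_real, norm_neg] at h1
  have hpos : (0 : ℝ) < (N₀ + 1 : ℕ) := by positivity
  have h2 : ε / 2 ≤ ((N₀ + 1 : ℕ) : ℝ)⁻¹ *
      ∑ m ∈ Finset.range (N₀ + 1), ∑ c ∈ t, f (m • g - c) := by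
    rw [le_inv_mul_iff₀ hpos]
    have := Finset.card_nsmul_le_sum (Finset.range (N₀ + 1))
      (fun m => ∑ c ∈ t, f (m • g - c)) (ε / 2) fun m _ => hlow _
    simpa using this
  exact absurd (h2.trans (Real.le_norm_self _)) (not_le.2 h1)

/-- Kronecker's theorem for angles. -/
theorem exists_nat_forall_abs_sub_lt {p : ℕ} {α : Fin p → ℝ}
    (hα : LinearIndependent ℚ (Fin.cons Real.pi α : Fin (p + 1) → ℝ)) (θ : Fin p → ℝ) {ε : ℝ}
    (hε : 0 < ε) :
    ∃ (m : ℕ) (k : Fin p → ℤ), ∀ j, |m * (2 * α j) - k j * (2 * Real.pi) - θ j| < ε := by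
  have hpi := Real.pi_pos
  -- The angle `2 * α j` measured in full turns.
  let g : UnitAddTorus (Fin p) := fun j => ((α j / Real.pi : ℝ) : UnitAddCircle)
  let y : UnitAddTorus (Fin p) := fun j => ((θ j / (2 * Real.pi) : ℝ) : UnitAddCircle)
  have hg : ∀ n : Fin p → ℤ, n ≠ 0 → UnitAddTorus.mFourier n g ≠ 1 := by
    intro n hn h1
    simp only [UnitAddTorus.mFourier, ContinuousMap.coe_mk, g, fourier_coe_apply] at h1
    rw [← Complex.exp_sum, Complex.exp_eq_one_iff] at h1
    obtain ⟨N, hN⟩ := h1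
    have hsum : ∑ j, (n j : ℝ) * α j = N * Real.pi := by
      have h2 : ((∑ j, (n j : ℝ) * α j : ℝ) : ℂ) * (2 * Complex.I) =
          ((N * Real.pi : ℝ) : ℂ) * (2 * Complex.I) := by
        push_cast
        rw [mul_assoc, mul_comm (Real.pi : ℂ), show (2 * Complex.I * (Real.pi : ℂ)) =
          2 * Real.pi * Complex.I by ring, ← hN, Finset.sum_mul]
        refine Finset.sum_congr rfl fun j _ => ?_
        have : (Real.pi : ℂ) ≠ 0 := by exact_mod_cast hpi.ne'
        push_cast
        field_simp
      exact_mod_cast mul_right_cancel₀ (by simp) h2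
    have := (Fintype.linearIndependent_iff.1 hα) (Fin.cons (-N : ℚ) fun j => (n j : ℚ)) (by
      simp only [Fin.sum_univ_succ, Fin.cons_zero, Fin.cons_succ, Rat.smul_def]
      push_cast
      rw [hsum]; ring)
    refine hn (funext fun j => ?_)
    have h3 := this j.succ
    simpa using h3
  obtain ⟨m, hm⟩ := UnitAddTorus.exists_nsmul_norm_sub_lt g hg y
    (ε := ε / (2 * Real.pi)) (by positivity)
  refine ⟨m, fun j => round (m * (α j / Real.pi) - θ j / (2 * Real.pi)), fun j => ?_⟩
  have h1 : ‖(m • g - y) j‖ < ε / (2 * Real.pi) := (norm_le_pi_norm _ j).trans_lt hm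
  have h2 : (m • g - y) j = ((m * (α j / Real.pi) - θ j / (2 * Real.pi) : ℝ) : UnitAddCircle) := by
    simp [g, y]
  rw [h2, UnitAddCircle.norm_eq, lt_div_iff₀ (by positivity)] at h1
  refine lt_of_eq_of_lt ?_ h1
  rw [← abs_of_pos (show 0 < 2 * Real.pi by positivity), ← abs_mul,
    abs_of_pos (show 0 < 2 * Real.pi by positivity)]
  congr 1
  field_simp
  ring

/-! ### Saturation along a subspace. -/

/-- With each of its points, `E` contains all points of the same norm that differ from it by a
vector of `V`. -/
def SaturatedAlong {F : Type*} [NormedAddCommGroup F] [InnerProductSpace ℝ F] (E : Set F)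
    (V : Submodule ℝ F) : Prop :=
  ∀ x ∈ E, ∀ y, ‖y‖ = ‖x‖ → y - x ∈ V → y ∈ E

namespace SaturatedAlong

variable {F : Type*} [NormedAddCommGroup F] [InnerProductSpace ℝ F] {E : Set F}
  {U V : Submodule ℝ F}

theorem mono (h : SaturatedAlong E V) (hUV : U ≤ V) : SaturatedAlong E U :=
  fun x hx y hy hyx => h x hx y hy (hUV hyx)

theorem compl (h : SaturatedAlong E V) : SaturatedAlong Eᶜ V :=
  fun x hx y hy hyx hyE => hx (h y hyE x hy.symm (by rw [← neg_sub]; exact V.neg_mem hyx))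

theorem eq_sphere (h : SaturatedAlong E ⊤)
    (hsub : E ⊆ Metric.sphere 0 1) (hne : E.Nonempty) : E = Metric.sphere 0 1 := by
  obtain ⟨x, hx⟩ := hne
  refine hsub.antisymm fun y hy => h x hx y ?_ trivial
  rw [mem_sphere_zero_iff_norm.1 hy, mem_sphere_zero_iff_norm.1 (hsub hx)]

/-- Conjugation by the isometry `ε • L.reflection`, which preserves `E` and is an involution because
`ε * ε = 1`. -/
theorem map_reflection [FiniteDimensional ℝ F] (h : SaturatedAlong E V) {L : Submodule ℝ F} {ε : ℝ}
    (hε : ε * ε = 1) (hR : ∀ x ∈ E, ε • L.reflection x ∈ E) :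
    SaturatedAlong E (V.map (L.reflection : F →ₗ[ℝ] F)) := by
  rintro x hx y hy ⟨v, hv, hvy⟩
  have := hR _ (h _ (hR x hx) (ε • L.reflection y) (by simp [norm_smul, hy]) (by
    rw [← smul_sub, ← map_sub, ← hvy]
    exact V.smul_mem ε (by simpa using hv)))
  simpa [smul_smul, hε] using this

end SaturatedAlong

/-! ### Sums of saturated subspaces with a common line. -/

section Equator

/-- The left side is the height along `f` of `ρ • a + t • f` after reflection in the hyperplane
orthogonal to `cos ψ • a + sin ψ • b`, where `s = ⟪b, f⟫`. It is `t` at `ψ = 0` and at most `t - s ^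
2 * r` at `ψ = π / 4`; intermediate values do the rest. -/
theorem exists_height_decrease {t ρ s r : ℝ} (ht : 0 ≤ t) (hρ : 0 ≤ ρ) (hs : 0 < s)
    (hs1 : s ≤ 1) (hr0 : 0 ≤ r) (hr : r ≤ ρ + t) :
    ∃ ψ : ℝ, t - 2 * (ρ * Real.cos ψ + t * s * Real.sin ψ) * Real.sin ψ * s =
      max 0 (t - s ^ 2 * r) := by
  let G : ℝ → ℝ := fun ψ => t - 2 * (ρ * Real.cos ψ + t * s * Real.sin ψ) * Real.sin ψ * s
  have hG : Continuous G := by fun_prop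
  have h0 : G 0 = t := by simp [G]
  have h1 : G (Real.pi / 4) ≤ t - s ^ 2 * r := by
    have h2 : Real.sqrt 2 * Real.sqrt 2 = 2 := Real.mul_self_sqrt (by norm_num)
    have h3 : G (Real.pi / 4) = t - s * ρ - s ^ 2 * t := by
      simp only [G, Real.cos_pi_div_four, Real.sin_pi_div_four]
      linear_combination (-(ρ * s + t * s ^ 2) / 2) * h2
    have h4 : s ^ 2 * ρ ≤ s * ρ := by
      nlinarith [mul_nonneg hs.le hρ]
    nlinarith [mul_le_mul_of_nonneg_left hr (sq_nonneg s)]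
  obtain ⟨ψ, hψ⟩ := intermediate_value_univ (Real.pi / 4) 0 hG
    (show max 0 (t - s ^ 2 * r) ∈ Set.Icc (G (Real.pi / 4)) (G 0) from
      ⟨h1.trans (le_max_right _ _), by
        rw [h0]; exact max_le ht (by nlinarith [mul_nonneg (sq_nonneg s) hr0])⟩)
  exact ⟨ψ, hψ⟩

variable {F : Type*} [NormedAddCommGroup F] [InnerProductSpace ℝ F] {E : Set F}
  {U V : Submodule ℝ F}

theorem norm_sq_add_add_smul {w v f : F} {t : ℝ} (hwv : ⟪w, v⟫ = 0) (hwf : ⟪w, f⟫ = 0)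
    (hvf : ⟪v, f⟫ = 0) (hf : ‖f‖ = 1) :
    ‖w + v + t • f‖ ^ 2 = ‖w‖ ^ 2 + ‖v‖ ^ 2 + t ^ 2 := by
  rw [norm_add_sq_real, norm_add_sq_real, inner_add_left, inner_smul_right, inner_smul_right, hwv,
    hwf, hvf, norm_smul, hf, Real.norm_eq_abs, mul_one, sq_abs]
  ring

/-- A set saturated along `V` and along a plane through `a ∈ V` and `v₁ + s • f`, with `f`
orthogonal to `V`, contains with any point of `w + V + ℝ f` a point of `w + V`. -/
theorem SaturatedAlong.add_smul_mem (hV : SaturatedAlong E V) (hU : SaturatedAlong E U)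
    {a b f w v₁ : F} {s r : ℝ} (haV : a ∈ V) (haU : a ∈ U) (hbU : b ∈ U) (ha : ‖a‖ = 1)
    (hb : ‖b‖ = 1) (hab : ⟪a, b⟫ = 0) (hf : ‖f‖ = 1) (hfV : f ∈ Vᗮ) (hwV : w ∈ Vᗮ)
    (hwf : ⟪w, f⟫ = 0) (hv₁ : v₁ ∈ V) (hbv : b = v₁ + s • f) (hs : 0 < s) (hr : 0 ≤ r) (N : ℕ) :
    ∀ v ∈ V, ∀ t, 0 ≤ t → t ≤ N * (s ^ 2 * r) → ‖v‖ ^ 2 + t ^ 2 = r ^ 2 →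
      w + v + t • f ∈ E → w + r • a ∈ E := by
  have hVf : ∀ v ∈ V, ⟪v, f⟫ = 0 := fun v hv => hfV v hv
  have hVw : ∀ v ∈ V, ⟪w, v⟫ = 0 := fun v hv => by rw [real_inner_comm]; exact hwV v hv
  have hn : ∀ v ∈ V, ∀ t : ℝ, ‖w + v + t • f‖ ^ 2 = ‖w‖ ^ 2 + ‖v‖ ^ 2 + t ^ 2 := fun v hv t =>
    norm_sq_add_add_smul (hVw v hv) hwf (hVf v hv) hf
  have hsa : ∀ c : ℝ, 0 ≤ c → ‖c • a‖ = c := fun c hc => by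
    rw [norm_smul, ha, mul_one, Real.norm_of_nonneg hc]
  -- `N` bounds the number of moves: each lowers the height by `s ^ 2 * r` or brings it to `0`,
  -- where saturation along `V` finishes.
  induction N with
  | zero =>
    intro v hv t ht0 ht hvt hx
    have ht' : t = 0 := le_antisymm (by simpa using ht) ht0
    subst ht'
    refine hV _ hx _ ?_ ?_
    · rw [← sq_eq_sq₀ (norm_nonneg _) (norm_nonneg _), hn v hv]
      have := hn (r • a) (V.smul_mem r haV) 0
      rw [zero_smul, add_zero, hsa r hr] at this
      rw [this]; linarith
    · have : w + r • a - (w + v + (0 : ℝ) • f) = r • a - v := by rw [zero_smul]; abel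
      rw [this]
      exact V.sub_mem (V.smul_mem r haV) hv
  | succ N ih =>
    intro v hv t ht0 ht hvt hx
    have hρ := norm_nonneg v
    set ρ := ‖v‖
    have hbf : ⟪b, f⟫ = s := by
      rw [hbv, inner_add_left, hVf v₁ hv₁, inner_smul_left, real_inner_self_eq_norm_sq, hf]
      simp
    have hs1 : s ≤ 1 := by
      have := real_inner_le_norm b f
      rwa [hbf, hb, hf, mul_one] at this
    obtain ⟨ψ, hψ⟩ := exists_height_decrease ht0 hρ hs hs1 hr (by nlinarith)
    set c := Real.cos ψ
    set d := Real.sin ψ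
    have hcd : d ^ 2 + c ^ 2 = 1 := Real.sin_sq_add_cos_sq ψ
    set κ := 2 * (ρ * c + t * s * d)
    -- Within `V` the component `v` is turned into the direction of `a`, the line shared with `U`.
    have hx₁ : w + ρ • a + t • f ∈ E := by
      refine hV _ hx _ ?_ ?_
      · rw [← sq_eq_sq₀ (norm_nonneg _) (norm_nonneg _), hn v hv, hn _ (V.smul_mem ρ haV),
          hsa ρ hρ]
      · have : w + ρ • a + t • f - (w + v + t • f) = ρ • a - v := by abel
        rw [this]
        exact V.sub_mem (V.smul_mem ρ haV) hv
    have hu : ‖c • a + d • b‖ ^ 2 = 1 := by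
      rw [norm_add_sq_real, inner_smul_left, inner_smul_right, hab, norm_smul, norm_smul, ha, hb]
      simp only [Real.norm_eq_abs, mul_one, mul_zero, add_zero, sq_abs]
      linarith
    have hxu : ⟪w + ρ • a + t • f, c • a + d • b⟫ = κ / 2 := by
      have hwb : ⟪w, b⟫ = 0 := by
        rw [hbv, inner_add_right, hVw v₁ hv₁, inner_smul_right, hwf]; simp
      simp only [inner_add_left, inner_add_right, real_inner_smul_left, real_inner_smul_right,
        hVw a haV, hwb, hab, real_inner_comm f b ▸ hbf, real_inner_comm f a ▸ hVf a haV,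
        real_inner_self_eq_norm_sq, ha]
      simp only [κ]; ring
    -- Reflection in the hyperplane orthogonal to a unit vector of `U` keeps the norm and moves the
    -- point by a vector of `U`.
    have hx₂ : w + ρ • a + t • f - κ • (c • a + d • b) ∈ E := by
      refine hU _ hx₁ _ ?_ ?_
      · rw [← sq_eq_sq₀ (norm_nonneg _) (norm_nonneg _), norm_sub_sq_real, real_inner_smul_right,
          hxu, norm_smul, mul_pow, hu, Real.norm_eq_abs, sq_abs]
        ring
      · rw [sub_sub_cancel_left]
        exact U.neg_mem (U.smul_mem _ (U.add_mem (U.smul_mem _ haU) (U.smul_mem _ hbU)))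
    set v₂ := (ρ - κ * c) • a - (κ * d) • v₁
    have hv₂ : v₂ ∈ V := V.sub_mem (V.smul_mem _ haV) (V.smul_mem _ hv₁)
    have hx₂' : w + ρ • a + t • f - κ • (c • a + d • b) = w + v₂ + (t - κ * d * s) • f := by
      rw [hbv]; simp only [v₂]; module
    have hnorm : ‖w + v₂ + (t - κ * d * s) • f‖ ^ 2 = ‖w + ρ • a + t • f‖ ^ 2 := by
      rw [← hx₂', norm_sub_sq_real, real_inner_smul_right, hxu, norm_smul, mul_pow, hu,
        Real.norm_eq_abs, sq_abs]
      ring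
    rw [hn v₂ hv₂, hn _ (V.smul_mem ρ haV), hsa ρ hρ] at hnorm
    rw [hx₂'] at hx₂
    refine ih v₂ hv₂ _ ?_ ?_ (by linarith) hx₂
    · rw [hψ]; exact le_max_left _ _
    · rw [hψ]
      refine max_le (by positivity) ?_
      push_cast at ht
      linarith

end Equator

namespace SaturatedAlong

variable {F : Type*} [NormedAddCommGroup F] [InnerProductSpace ℝ F] {E : Set F}
  {U V : Submodule ℝ F}

/-- The point `w + r • a` lies in `E` if `w + v + t • f` does, for `t` of either sign. -/
theorem add_smul_mem_of_eq (hV : SaturatedAlong E V) (hU : SaturatedAlong E U)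
    {a b f w v₁ v : F} {s r t : ℝ} (haV : a ∈ V) (haU : a ∈ U) (hbU : b ∈ U) (ha : ‖a‖ = 1)
    (hb : ‖b‖ = 1) (hab : ⟪a, b⟫ = 0) (hf : ‖f‖ = 1) (hfV : f ∈ Vᗮ) (hwV : w ∈ Vᗮ)
    (hwf : ⟪w, f⟫ = 0) (hv₁ : v₁ ∈ V) (hbv : b = v₁ + s • f) (hs : 0 < s) (hr : 0 ≤ r)
    (hv : v ∈ V) (hvt : ‖v‖ ^ 2 + t ^ 2 = r ^ 2) (hx : w + v + t • f ∈ E) : w + r • a ∈ E := by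
  rcases hr.eq_or_lt with rfl | hr0
  · have h0 : t = 0 := by nlinarith [sq_nonneg ‖v‖]
    exact hV.add_smul_mem hU haV haU hbU ha hb hab hf hfV hwV hwf hv₁ hbv hs hr 0 v hv t h0.ge
      (by simp [h0]) hvt hx
  have hδ : 0 < s ^ 2 * r := by positivity
  obtain ⟨N, hN⟩ := exists_nat_ge (|t| / (s ^ 2 * r))
  rw [div_le_iff₀ hδ] at hN
  rcases le_total 0 t with ht | ht
  · rw [abs_of_nonneg ht] at hN
    exact hV.add_smul_mem hU haV haU hbU ha hb hab hf hfV hwV hwf hv₁ hbv hs hr N v hv t ht hN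
      hvt hx
  · rw [abs_of_nonpos ht] at hN
    -- Changing the signs of `f`, `b` and `v₁` together makes the height nonnegative and keeps `s`.
    refine hV.add_smul_mem hU haV haU (U.neg_mem hbU) ha (by rwa [norm_neg])
      (by rw [inner_neg_right, hab, neg_zero]) (f := -f) (by rwa [norm_neg]) (Vᗮ.neg_mem hfV) hwV
      (by rw [inner_neg_right, hwf, neg_zero]) (V.neg_mem hv₁) (s := s) (by rw [hbv]; module) hs hr
      N v hv (-t) (by linarith) hN (by rw [neg_sq]; exact hvt) ?_
    rwa [smul_neg, neg_smul, neg_neg]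

/-- Two points `x`, `y` of equal norm differing by a vector of the sum have the same component `w`
orthogonal to it, and both can be moved to the same point `w + r • a`. If `x ∈ E` and `y ∉ E`, this
point would lie in `E` and, since `Eᶜ` is saturated too, also in `Eᶜ`. -/
theorem sup_span_singleton [FiniteDimensional ℝ F] (hV : SaturatedAlong E V)
    (hU : SaturatedAlong E U) {a u : F} (ha0 : a ≠ 0) (haV : a ∈ V) (haU : a ∈ U) (huU : u ∈ U) :
    SaturatedAlong E (V ⊔ Submodule.span ℝ {u}) := by
  wlog ha : ‖a‖ = 1 generalizing a
  · refine this (a := ‖a‖⁻¹ • a) (by simpa using ha0) (V.smul_mem _ haV) (U.smul_mem _ haU) ?_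
    rw [norm_smul, norm_inv, norm_norm, inv_mul_cancel₀ (norm_ne_zero_iff.2 ha0)]
  by_cases huV : u ∈ V
  · rwa [sup_eq_left.2 ((Submodule.span_singleton_le_iff_mem u V).2 huV)]
  have hPu : V.starProjection u ∈ V := V.starProjection_apply_mem u
  have hg : u - V.starProjection u ∈ Vᗮ := V.sub_starProjection_mem_orthogonal u
  set g := u - V.starProjection u with hgdef
  have hg0 : 0 < ‖g‖ := norm_pos_iff.2 fun h => huV (by rw [sub_eq_zero.1 h]; exact hPu)
  set f := ‖g‖⁻¹ • g with hfdef
  have hf : ‖f‖ = 1 := by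
    rw [hfdef, norm_smul, norm_inv, norm_norm, inv_mul_cancel₀ hg0.ne']
  have hfV : f ∈ Vᗮ := Vᗮ.smul_mem _ hg
  have huf : u = V.starProjection u + ‖g‖ • f := by
    rw [hfdef, smul_smul, mul_inv_cancel₀ hg0.ne', one_smul, hgdef]; abel
  -- Gram–Schmidt inside `U`: `b₀` is orthogonal to `a` and has the same component `‖g‖ • f` outside
  -- `V` as `u`.
  set b₀ := u - ⟪a, u⟫ • a with hb₀
  have hb₀f : b₀ = V.starProjection u - ⟪a, u⟫ • a + ‖g‖ • f := by
    rw [hb₀, sub_add_eq_add_sub, ← huf]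
  have hb₀U : b₀ ∈ U := U.sub_mem huU (U.smul_mem _ haU)
  have hb₀0 : 0 < ‖b₀‖ := norm_pos_iff.2 fun h => huV (by
    rw [sub_eq_zero.1 h]; exact V.smul_mem _ haV)
  have hab₀ : ⟪a, b₀⟫ = 0 := by
    rw [hb₀, inner_sub_right, real_inner_smul_right, real_inner_self_eq_norm_sq, ha]; ring
  have key : ∀ {E' : Set F}, SaturatedAlong E' V → SaturatedAlong E' U → ∀ {w v : F} {r t : ℝ},
      w ∈ Vᗮ → ⟪w, f⟫ = 0 → v ∈ V → 0 ≤ r → ‖v‖ ^ 2 + t ^ 2 = r ^ 2 → w + v + t • f ∈ E' →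
      w + r • a ∈ E' := fun hV' hU' w v r t hwV hwf hv hr hvt hx =>
    hV'.add_smul_mem_of_eq hU' haV haU (b := ‖b₀‖⁻¹ • b₀) (U.smul_mem _ hb₀U) ha
      (by rw [norm_smul, norm_inv, norm_norm, inv_mul_cancel₀ hb₀0.ne'])
      (by rw [real_inner_smul_right, hab₀, mul_zero]) hf hfV hwV hwf
      (v₁ := ‖b₀‖⁻¹ • (V.starProjection u - ⟪a, u⟫ • a))
      (V.smul_mem _ (V.sub_mem hPu (V.smul_mem _ haV))) (s := ‖b₀‖⁻¹ * ‖g‖)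
      (by rw [mul_smul, ← smul_add, ← hb₀f]) (by positivity) hr hv hvt hx
  have hsup : ∀ z ∈ V ⊔ Submodule.span ℝ {u}, ∃ v ∈ V, ∃ t : ℝ, z = v + t • f := by
    intro z hz
    obtain ⟨v, hv, q, hq, rfl⟩ := Submodule.mem_sup.1 hz
    obtain ⟨c, rfl⟩ := Submodule.mem_span_singleton.1 hq
    refine ⟨v + c • V.starProjection u, V.add_mem hv (V.smul_mem _ hPu), c * ‖g‖, ?_⟩
    nth_rewrite 1 [huf]
    module
  intro x hx y hyx hy
  by_contra hyE
  obtain ⟨v', hv', t', hvt'⟩ := hsup _ hy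
  have hVf : ∀ v ∈ V, ⟪v, f⟫ = 0 := fun v hv => hfV v hv
  set t := ⟪x, f⟫ with ht
  set v := V.starProjection x with hv
  have hvV : v ∈ V := V.starProjection_apply_mem x
  set w := x - v - t • f with hw
  have hwV : w ∈ Vᗮ := Vᗮ.sub_mem (V.sub_starProjection_mem_orthogonal x) (Vᗮ.smul_mem _ hfV)
  have hwf : ⟪w, f⟫ = 0 := by
    rw [hw, inner_sub_left, inner_sub_left, hVf v hvV, real_inner_smul_left,
      real_inner_self_eq_norm_sq, hf]
    simp [ht]
  have hVw : ∀ v ∈ V, ⟪w, v⟫ = 0 := fun v hv => by rw [real_inner_comm]; exact hwV v hv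
  have hxw : x = w + v + t • f := by rw [hw]; abel
  have hyw : y = w + (v + v') + (t + t') • f := by
    rw [← sub_add_cancel y x, hvt', hxw]; module
  have hvv' := V.add_mem hvV hv'
  have hnx := norm_sq_add_add_smul (t := t) (hVw v hvV) hwf (hVf v hvV) hf
  have hny := norm_sq_add_add_smul (t := t + t') (hVw _ hvv') hwf (hVf _ hvv') hf
  rw [← hxw] at hnx
  rw [← hyw, hyx] at hny
  have hr := Real.sq_sqrt (show 0 ≤ ‖v‖ ^ 2 + t ^ 2 by positivity)
  have hr0 := Real.sqrt_nonneg (‖v‖ ^ 2 + t ^ 2)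
  have h1 := key hV hU hwV hwf hvV hr0 hr.symm (by rwa [← hxw])
  have h2 := key hV.compl hU.compl hwV hwf hvv' hr0 (t := t + t') (by rw [hr]; linarith)
    (by rw [← hyw]; exact hyE)
  exact h2 h1

/-- There is a largest subspace above `V` along which `E` is saturated, and it contains every
subspace that meets it nontrivially and along which `E` is saturated. -/
theorem exists_absorbing [FiniteDimensional ℝ F] (hV : SaturatedAlong E V) :
    ∃ W, V ≤ W ∧ SaturatedAlong E W ∧
      ∀ U, SaturatedAlong E U → W ⊓ U ≠ ⊥ → U ≤ W := by
  obtain ⟨W, ⟨hVW, hW⟩, hmax⟩ := WellFounded.has_min (wellFounded_gt (α := Submodule ℝ F))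
    {W | V ≤ W ∧ SaturatedAlong E W} ⟨V, le_rfl, hV⟩
  refine ⟨W, hVW, hW, fun U hU hWU u hu => ?_⟩
  obtain ⟨a, ha, ha0⟩ := Submodule.exists_mem_ne_zero_of_ne_bot hWU
  have h := hW.sup_span_singleton hU ha0 ha.1 ha.2 hu
  by_contra huW
  refine hmax _ ⟨hVW.trans le_sup_left, h⟩ (lt_of_le_of_ne le_sup_left fun heq => huW ?_)
  rw [heq]
  exact Submodule.mem_sup_right (Submodule.mem_span_singleton_self u)

theorem sup [FiniteDimensional ℝ F] (hV : SaturatedAlong E V) (hU : SaturatedAlong E U)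
    (hVU : V ⊓ U ≠ ⊥) : SaturatedAlong E (V ⊔ U) := by
  obtain ⟨W, hVW, hW, hmax⟩ := hV.exists_absorbing
  refine hW.mono (sup_le hVW (hmax U hU fun h => hVU ?_))
  exact le_bot_iff.1 ((inf_le_inf_right U hVW).trans h.le)

end SaturatedAlong

/-! ### Products of two reflections as rotations of planes. -/

theorem Submodule.reflection_span_range_apply {F ι : Type*} [NormedAddCommGroup F]
    [InnerProductSpace ℝ F] [FiniteDimensional ℝ F] [Fintype ι] {g : ι → F}
    (hg : Orthonormal ℝ g) (x : F) :
    (Submodule.span ℝ (Set.range g)).reflection x = (2 : ℝ) • ∑ j, ⟪g j, x⟫ • g j - x := by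
  classical
  have h : (Submodule.span ℝ (Set.range g)).starProjection x = ∑ j, ⟪g j, x⟫ • g j := by
    refine Submodule.eq_starProjection_of_mem_of_inner_eq_zero
      (Submodule.sum_mem _ fun j _ => Submodule.smul_mem _ _
        (Submodule.subset_span (Set.mem_range_self j))) fun w hw => ?_
    induction hw using Submodule.span_induction with
    | mem w hw =>
      obtain ⟨i, rfl⟩ := hw
      rw [real_inner_comm, inner_sub_right, hg.inner_right_fintype, sub_self]
    | zero => simp
    | add a b _ _ ha hb => rw [inner_add_right, ha, hb, add_zero]
    | smul c a _ ha => rw [inner_smul_right, ha, mul_zero]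
  rw [Submodule.reflection_apply, h, two_smul ℕ, two_smul ℝ]

section Rotation

variable {F : Type*} [NormedAddCommGroup F] [InnerProductSpace ℝ F] {p : ℕ} {u v : Fin p → F}

/-- The rotation by the angle `θ j` in each of the planes `span {u j, v j}`. -/
noncomputable def planeRotation (u v : Fin p → F) (θ : Fin p → ℝ) (x : F) : F :=
  x + ∑ j, (((Real.cos (θ j) - 1) * ⟪u j, x⟫ - Real.sin (θ j) * ⟪v j, x⟫) • u j +
    (Real.sin (θ j) * ⟪u j, x⟫ + (Real.cos (θ j) - 1) * ⟪v j, x⟫) • v j)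

theorem continuous_planeRotation (u v : Fin p → F) (x : F) :
    Continuous fun θ => planeRotation u v θ x := by
  unfold planeRotation
  fun_prop

theorem planeRotation_sub_int_mul_two_pi (θ : Fin p → ℝ) (k : Fin p → ℤ) (x : F) :
    planeRotation u v (fun j => θ j - k j * (2 * Real.pi)) x = planeRotation u v θ x := by
  simp only [planeRotation, Real.cos_sub_int_mul_two_pi, Real.sin_sub_int_mul_two_pi]

theorem inner_left_planeRotation (huu : ∀ i j, ⟪u i, u j⟫ = if i = j then 1 else 0)
    (huv : ∀ i j, ⟪u i, v j⟫ = 0) (θ : Fin p → ℝ) (x : F) (i : Fin p) :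
    ⟪u i, planeRotation u v θ x⟫ = Real.cos (θ i) * ⟪u i, x⟫ - Real.sin (θ i) * ⟪v i, x⟫ := by
  simp only [planeRotation, inner_add_right, inner_sum, real_inner_smul_right, huu, huv]
  simp
  ring

theorem inner_right_planeRotation (hvv : ∀ i j, ⟪v i, v j⟫ = if i = j then 1 else 0)
    (huv : ∀ i j, ⟪u i, v j⟫ = 0) (θ : Fin p → ℝ) (x : F) (i : Fin p) :
    ⟪v i, planeRotation u v θ x⟫ = Real.sin (θ i) * ⟪u i, x⟫ + Real.cos (θ i) * ⟪v i, x⟫ := by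
  simp only [planeRotation, inner_add_right, inner_sum, real_inner_smul_right, hvv,
    real_inner_comm (u _) (v _), huv]
  simp
  ring

/-- In each plane the two reflections are in lines at angle `α j`, so their product turns by `2 * α
j`; on the orthogonal complement of the planes both are `-1`. -/
theorem reflection_reflection_planeRotation [FiniteDimensional ℝ F]
    (huu : ∀ i j, ⟪u i, u j⟫ = if i = j then 1 else 0)
    (hvv : ∀ i j, ⟪v i, v j⟫ = if i = j then 1 else 0) (huv : ∀ i j, ⟪u i, v j⟫ = 0)
    (α θ : Fin p → ℝ) (x : F) :
    (Submodule.span ℝ (Set.range fun j =>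
      Real.cos (α j) • u j + Real.sin (α j) • v j)).reflection
        ((Submodule.span ℝ (Set.range u)).reflection (planeRotation u v θ x)) =
      planeRotation u v (fun j => θ j + 2 * α j) x := by
  have hu : Orthonormal ℝ u := orthonormal_iff_ite.2 huu
  have hg : Orthonormal ℝ fun j => Real.cos (α j) • u j + Real.sin (α j) • v j := by
    refine orthonormal_iff_ite.2 fun i j => ?_
    simp only [inner_add_left, inner_add_right, real_inner_smul_left, real_inner_smul_right, huu,
      hvv, huv, real_inner_comm (u _) (v _)]
    split_ifs with h
    · subst h
      linear_combination Real.sin_sq_add_cos_sq (α i)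
    · simp
  set y := planeRotation u v θ x with hy
  rw [Submodule.reflection_span_range_apply hg, Submodule.reflection_span_range_apply hu]
  have h1 : ∀ i, ⟪Real.cos (α i) • u i + Real.sin (α i) • v i,
      (2 : ℝ) • ∑ j, ⟪u j, y⟫ • u j - y⟫ =
      Real.cos (α i) * ⟪u i, y⟫ - Real.sin (α i) * ⟪v i, y⟫ := by
    intro i
    simp only [inner_add_left, inner_sub_right, real_inner_smul_left, real_inner_smul_right,
      inner_sum, huu, real_inner_comm (u _) (v _), huv]
    simp
    ring
  simp only [h1]
  rw [show ∀ a b c : F, a - (b - c) = c + (a - b) from fun a b c => by abel, hy]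
  simp only [inner_left_planeRotation huu huv, inner_right_planeRotation hvv huv]
  nth_rewrite 1 [planeRotation]
  rw [planeRotation, add_assoc, ← smul_sub, ← Finset.sum_sub_distrib, Finset.smul_sum,
    ← Finset.sum_add_distrib]
  congr 1
  refine Finset.sum_congr rfl fun j _ => ?_
  rw [Real.cos_add, Real.sin_add, Real.cos_two_mul, Real.sin_two_mul]
  match_scalars
  · ring
  · linear_combination (-2 * (Real.sin (θ j) * ⟪u j, x⟫ + Real.cos (θ j) * ⟪v j, x⟫)) *
      Real.sin_sq_add_cos_sq (α j)

end Rotation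

theorem exists_cos_eq_sin_eq {a b : ℝ} (h : a ^ 2 + b ^ 2 = 1) :
    ∃ φ : ℝ, Real.cos φ = a ∧ Real.sin φ = b := by
  have hz : ‖(⟨a, b⟩ : ℂ)‖ = 1 := by
    rw [← sq_eq_sq₀ (norm_nonneg _) zero_le_one, Complex.sq_norm, Complex.normSq_mk]
    linarith
  obtain ⟨φ, hφ⟩ := Complex.norm_eq_one_iff _ |>.1 hz
  exact ⟨φ, by rw [← Complex.exp_ofReal_mul_I_re, hφ], by rw [← Complex.exp_ofReal_mul_I_im, hφ]⟩

theorem exists_rotation_eq {a b c d : ℝ} (h : a ^ 2 + b ^ 2 = c ^ 2 + d ^ 2) :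
    ∃ φ : ℝ, Real.cos φ * a - Real.sin φ * b = c ∧ Real.sin φ * a + Real.cos φ * b = d := by
  by_cases h0 : a ^ 2 + b ^ 2 = 0
  · have ha : a = 0 := by nlinarith [sq_nonneg a, sq_nonneg b]
    have hb : b = 0 := by nlinarith [sq_nonneg a, sq_nonneg b]
    have hc : c = 0 := by nlinarith [sq_nonneg c, sq_nonneg d]
    have hd : d = 0 := by nlinarith [sq_nonneg c, sq_nonneg d]
    exact ⟨0, by simp [ha, hc], by simp [hb, hd]⟩
  -- Real and imaginary part of the quotient `(c + d i) / (a + b i)`.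
  · have hcirc : ((a * c + b * d) / (a ^ 2 + b ^ 2)) ^ 2 +
        ((a * d - b * c) / (a ^ 2 + b ^ 2)) ^ 2 = 1 := by
      field_simp
      linear_combination -(a ^ 2 + b ^ 2) * h
    obtain ⟨φ, h1, h2⟩ := exists_cos_eq_sin_eq hcirc
    refine ⟨φ, ?_, ?_⟩
    · rw [h1, h2]; field_simp; ring
    · rw [h1, h2]; field_simp; ring

/-- Powers of the product approximate every choice of angles, and `E` is closed; so one plane can be
turned while the others stay fixed. -/
theorem saturatedAlong_span_pair {F : Type*} [NormedAddCommGroup F] [InnerProductSpace ℝ F]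
    [FiniteDimensional ℝ F] {p : ℕ} {u v : Fin p → F} {α : Fin p → ℝ}
    (huu : ∀ i j, ⟪u i, u j⟫ = if i = j then 1 else 0)
    (hvv : ∀ i j, ⟪v i, v j⟫ = if i = j then 1 else 0) (huv : ∀ i j, ⟪u i, v j⟫ = 0)
    (hα : LinearIndependent ℚ (Fin.cons Real.pi α : Fin (p + 1) → ℝ)) {E : Set F}
    (hE : IsClosed E)
    (hR : ∀ x ∈ E, (Submodule.span ℝ (Set.range fun j =>
      Real.cos (α j) • u j + Real.sin (α j) • v j)).reflection
        ((Submodule.span ℝ (Set.range u)).reflection x) ∈ E) (j : Fin p) :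
    SaturatedAlong E (Submodule.span ℝ {u j, v j}) := by
  intro x hx y hyx hy
  have hiter : ∀ m : ℕ, planeRotation u v (fun j => m * (2 * α j)) x ∈ E := by
    intro m
    induction m with
    | zero => simpa [planeRotation] using hx
    | succ m ih =>
      have := hR _ ih
      rw [reflection_reflection_planeRotation huu hvv huv] at this
      convert this using 3
      push_cast; ring
  have hall : ∀ θ, planeRotation u v θ x ∈ E := by
    intro θ
    have hcl := hE.preimage (continuous_planeRotation u v x)
    refine hcl.closure_subset (Metric.mem_closure_iff.2 fun ε hε => ?_)
    obtain ⟨m, k, hmk⟩ := exists_nat_forall_abs_sub_lt hα θ hε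
    refine ⟨fun j => m * (2 * α j) - k j * (2 * Real.pi), ?_, ?_⟩
    · change planeRotation u v _ x ∈ E
      rw [planeRotation_sub_int_mul_two_pi (fun j => m * (2 * α j))]
      exact hiter m
    · rw [dist_comm, dist_pi_lt_iff hε]
      exact fun j => by rw [Real.dist_eq]; exact hmk j
  obtain ⟨c, d, hcd⟩ := Submodule.mem_span_pair.1 hy
  have hyeq : y = x + (c • u j + d • v j) := by rw [hcd]; abel
  have hnorm : ‖y‖ ^ 2 = ‖x‖ ^ 2 := by rw [hyx]
  have hnu : ‖u j‖ ^ 2 = 1 := by rw [← real_inner_self_eq_norm_sq, huu]; simp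
  have hnv : ‖v j‖ ^ 2 = 1 := by rw [← real_inner_self_eq_norm_sq, hvv]; simp
  rw [hyeq, norm_add_sq_real, norm_add_sq_real, inner_add_right, real_inner_smul_right,
    real_inner_smul_right, real_inner_smul_left, real_inner_smul_right, huv, norm_smul, norm_smul,
    mul_pow, mul_pow, hnu, hnv, Real.norm_eq_abs, Real.norm_eq_abs, sq_abs, sq_abs,
    real_inner_comm, real_inner_comm (v j)] at hnorm
  obtain ⟨φ, h1, h2⟩ := exists_rotation_eq (a := ⟪u j, x⟫) (b := ⟪v j, x⟫) (c := ⟪u j, x⟫ + c)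
    (d := ⟪v j, x⟫ + d) (by linarith)
  convert hall (Pi.single j φ) using 1
  rw [hyeq, planeRotation, Finset.sum_eq_single j (fun i _ hij => by simp [hij]) (by simp),
    Pi.single_eq_same]
  congr 3
  · linarith
  · linarith

/-! ### Adding a subspace by reflecting in it. -/

section Chain

variable {F : Type*} [NormedAddCommGroup F] [InnerProductSpace ℝ F] [FiniteDimensional ℝ F]

/-- Dually: if `z` is orthogonal to `V` and to its mirror image, then the projection of `z` on `L`
is orthogonal to `V`, hence zero, so `z ∈ Lᗮ`. -/
theorem Submodule.le_sup_map_reflection {V L : Submodule ℝ F} (h : L ⊓ Vᗮ = ⊥) :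
    L ≤ V ⊔ V.map (L.reflection : F →ₗ[ℝ] F) := by
  rw [← Submodule.orthogonal_le_orthogonal_iff, ← Submodule.inf_orthogonal]
  rintro z ⟨hzV, hzR⟩
  have hP : L.starProjection z ∈ L ⊓ Vᗮ := by
    refine ⟨L.starProjection_apply_mem z, fun v hv => ?_⟩
    have h1 : ⟪v, z⟫ = 0 := hzV v hv
    have h2 : ⟪L.reflection v, z⟫ = 0 := hzR _ ⟨v, hv, rfl⟩
    rw [Submodule.reflection_apply, inner_sub_left, h1, two_smul, inner_add_left, sub_zero] at h2
    rw [← Submodule.inner_starProjection_left_eq_right]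
    linarith
  rw [h, Submodule.mem_bot] at hP
  have := L.sub_starProjection_mem_orthogonal z
  rwa [hP, sub_zero] at this

/-- By dimension `V` meets `Lᗮ`, where the reflection is `-1`; such vectors lie in both subspaces.
-/
theorem Submodule.inf_map_reflection_ne_bot {V L : Submodule ℝ F}
    (h : Module.finrank ℝ L < Module.finrank ℝ V) :
    V ⊓ V.map (L.reflection : F →ₗ[ℝ] F) ≠ ⊥ := by
  have hVL : V ⊓ Lᗮ ≠ ⊥ := fun hbot => by
    have h1 := Submodule.finrank_add_finrank_le_of_disjoint (disjoint_iff.2 hbot)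
    have h2 := L.finrank_add_finrank_orthogonal
    omega
  obtain ⟨a, ⟨haV, haL⟩, ha0⟩ := Submodule.exists_mem_ne_zero_of_ne_bot hVL
  refine (Submodule.ne_bot_iff _).2 ⟨a, ⟨haV, -a, V.neg_mem haV, ?_⟩, ha0⟩
  have := L.reflection_mem_subspace_orthogonalComplement_eq_neg haL
  simpa [neg_eq_iff_eq_neg] using this

theorem SaturatedAlong.sup_of_reflection {E : Set F} {V L : Submodule ℝ F}
    (hV : SaturatedAlong E V) {ε : ℝ} (hε : ε * ε = 1) (hR : ∀ x ∈ E, ε • L.reflection x ∈ E)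
    (hdim : Module.finrank ℝ L < Module.finrank ℝ V) (hL : L ⊓ Vᗮ = ⊥) :
    SaturatedAlong E (V ⊔ L) :=
  (hV.sup (hV.map_reflection hε hR) (Submodule.inf_map_reflection_ne_bot hdim)).mono
    (sup_le le_sup_left (Submodule.le_sup_map_reflection hL))

end Chain

/-! ### The rotated triple and its chain of planes. -/

theorem nextIdx_inj {p : ℕ} {i j : Fin p} : nextIdx i = nextIdx j ↔ i = j := by
  simp only [nextIdx, Fin.ext_iff]; omega

theorem oddIdx_inj {p : ℕ} {i j : Fin p} : oddIdx i = oddIdx j ↔ i = j := by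
  simp only [oddIdx, Fin.ext_iff]; omega

theorem prevIdx_val {p : ℕ} (j : Fin p) :
    (prevIdx j : ℕ) = if (j : ℕ) = 0 then 2 * p - 1 else 2 * (j : ℕ) - 1 := by
  unfold prevIdx; split_ifs <;> rfl

theorem prevIdx_inj {p : ℕ} {i j : Fin p} : prevIdx i = prevIdx j ↔ i = j := by
  have := i.isLt
  have := j.isLt
  simp only [Fin.ext_iff, prevIdx_val]
  split_ifs <;> omega

theorem oddIdx_ne_nextIdx {p : ℕ} (i j : Fin p) : oddIdx i ≠ nextIdx j := by
  simp only [oddIdx, nextIdx, ne_eq, Fin.ext_iff]; omega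

theorem oddIdx_ne_prevIdx {p : ℕ} (i j : Fin p) : oddIdx i ≠ prevIdx j := by
  have := i.isLt
  simp only [ne_eq, Fin.ext_iff, prevIdx_val, oddIdx]
  split_ifs <;> omega

/-- Consecutive basis vectors span planes taken alternately from the two families, so a maximal
saturated `W` containing the first plane absorbs them one after another. -/
theorem IsRotatedTriple.saturatedAlong {n p : ℕ}
    {L₁ L₂ L₃ : Submodule ℝ (EuclideanSpace ℝ (Fin n))} (h : IsRotatedTriple p L₁ L₂ L₃)
    (hp : 0 < p) {E : Set (EuclideanSpace ℝ (Fin n))} (hE : IsClosed E)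
    (h₁₂ : ∀ x ∈ E, L₂.reflection (L₁.reflection x) ∈ E)
    (h₁₃ : ∀ x ∈ E, L₃.reflection (L₁.reflection x) ∈ E) :
    SaturatedAlong E (L₁ ⊔ L₂ ⊔ L₃) := by
  obtain ⟨hpn, e, α, -, -, hα, rfl, rfl, rfl⟩ := h
  have he : ∀ a b : Fin (2 * p), ⟪e (Fin.castLE hpn a), e (Fin.castLE hpn b)⟫ =
      if a = b then 1 else 0 := fun a b => by
    rw [orthonormal_iff_ite.1 e.orthonormal]
    simp only [Fin.castLE_inj]
  have hnext := saturatedAlong_span_pair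
    (u := fun j : Fin p => e (Fin.castLE hpn (oddIdx j)))
    (v := fun j => e (Fin.castLE hpn (nextIdx j)))
    (fun i j => by simp only [he, oddIdx_inj])
    (fun i j => by simp only [he, nextIdx_inj])
    (fun i j => by rw [he, if_neg (oddIdx_ne_nextIdx i j)]) hα hE h₁₂
  have hprev := saturatedAlong_span_pair
    (u := fun j : Fin p => e (Fin.castLE hpn (oddIdx j)))
    (v := fun j => e (Fin.castLE hpn (prevIdx j)))
    (fun i j => by simp only [he, oddIdx_inj])
    (fun i j => by simp only [he, prevIdx_inj])
    (fun i j => by rw [he, if_neg (oddIdx_ne_prevIdx i j)]) hα hE h₁₃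
  obtain ⟨W, hW₀, hW, habs⟩ := (hnext ⟨0, hp⟩).exists_absorbing
  have hstep : ∀ (U : Submodule ℝ (EuclideanSpace ℝ (Fin n))) (a b : Fin n),
      SaturatedAlong E U → e a ∈ U → e b ∈ U → e a ∈ W → e b ∈ W := fun U a b hU ha hb haW =>
    habs U hU ((Submodule.ne_bot_iff _).2 ⟨e a, ⟨haW, ha⟩, e.orthonormal.ne_zero a⟩) hb
  have hmem : ∀ (m : ℕ) (hm : m < 2 * p), e (Fin.castLE hpn ⟨m, hm⟩) ∈ W := by
    intro m
    induction m with
    | zero => exact fun _ => hW₀ (Submodule.subset_span (Or.inl rfl))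
    | succ m ih =>
      intro hm
      have hmW := ih (by omega)
      rcases Nat.even_or_odd' m with ⟨j, rfl | rfl⟩
      -- Counted from zero, `hnext j` joins the indices `2j` and `2j+1`; in the odd case `hprev
      -- (j+1)` joins `2j+1` and `2j+2`.
      · exact hstep _ _ _ (hnext ⟨j, by omega⟩) (Submodule.subset_span (Or.inl rfl))
          (Submodule.subset_span (Or.inr rfl)) hmW
      · have hj : prevIdx (⟨j + 1, by omega⟩ : Fin p) = ⟨2 * j + 1, by omega⟩ := by
          rw [Fin.ext_iff, prevIdx_val]; simp; omega
        refine hstep _ _ _ (hprev ⟨j + 1, by omega⟩) (Submodule.subset_span (Or.inr ?_))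
          (Submodule.subset_span (Or.inl rfl)) hmW
        rw [hj]; rfl
  have hmem' : ∀ a : Fin (2 * p), e (Fin.castLE hpn a) ∈ W := fun a => hmem a a.isLt
  refine hW.mono (sup_le (sup_le ?_ ?_) ?_) <;> rw [Submodule.span_le] <;> rintro _ ⟨j, rfl⟩
  · exact hmem' _
  · exact W.add_mem (W.smul_mem _ (hmem' _)) (W.smul_mem _ (hmem' _))
  · exact W.add_mem (W.smul_mem _ (hmem' _)) (W.smul_mem _ (hmem' _))

/-- Supplies the strict dimension inequality needed to add further subspaces: the first generator of
`L₂` has the component `sin α ≠ 0` along a basis vector orthogonal to `L₁`. -/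
theorem IsRotatedTriple.lt_sup {n p : ℕ}
    {L₁ L₂ L₃ : Submodule ℝ (EuclideanSpace ℝ (Fin n))} (h : IsRotatedTriple p L₁ L₂ L₃)
    (hp : 0 < p) : L₁ < L₁ ⊔ L₂ ⊔ L₃ := by
  obtain ⟨hpn, e, α, -, hα, -, rfl, rfl, rfl⟩ := h
  refine lt_of_lt_of_le (left_lt_sup.2 fun hle => ?_) le_sup_left
  have h1 := hle (Submodule.subset_span (Set.mem_range_self (⟨0, hp⟩ : Fin p)))
  have h2 : e (Fin.castLE hpn (nextIdx ⟨0, hp⟩)) ∈ (Submodule.span ℝ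
      (Set.range fun j : Fin p => e (Fin.castLE hpn (oddIdx j))))ᗮ := by
    refine (Submodule.mem_orthogonal _ _).2 fun w hw => ?_
    induction hw using Submodule.span_induction with
    | mem w hw =>
      obtain ⟨j, rfl⟩ := hw
      exact e.orthonormal.2 (by simpa only [ne_eq, Fin.castLE_inj] using oddIdx_ne_nextIdx j _)
    | zero => simp
    | add a b _ _ ha hb => rw [inner_add_left, ha, hb, add_zero]
    | smul c a _ ha => rw [inner_smul_left, ha, mul_zero]
  have h3 := h2 _ h1
  have hsin : 0 < Real.sin (α ⟨0, hp⟩) :=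
    Real.sin_pos_of_pos_of_lt_pi (hα _).1 ((hα _).2.trans (by linarith [Real.pi_pos]))
  have hne : Fin.castLE hpn (oddIdx ⟨0, hp⟩) ≠ Fin.castLE hpn (nextIdx ⟨0, hp⟩) := by
    simpa only [ne_eq, Fin.castLE_inj] using oddIdx_ne_nextIdx _ _
  rw [inner_add_left, real_inner_smul_left, real_inner_smul_left, e.orthonormal.2 hne,
    real_inner_self_eq_norm_sq, e.orthonormal.1] at h3
  linarith

/-! ### Conclusion: saturation along the whole space. -/

theorem ReflectionConditions.saturatedAlong_top {n k p : ℕ} {hk : 3 ≤ k}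
    {L : Fin k → Submodule ℝ (EuclideanSpace ℝ (Fin n))} (hL : ReflectionConditions hk p L)
    (hp : 0 < p) (hdim : ∀ j, Module.finrank ℝ (L j) = p) {E : Set (EuclideanSpace ℝ (Fin n))}
    (hE : IsClosed E) {ε : ℝ} (hε : ε * ε = 1) (hR : ∀ j, ∀ x ∈ E, ε • (L j).reflection x ∈ E) :
    SaturatedAlong E ⊤ := by
  -- The sign cancels in a product of two reflections, so the triple is treated alike for `ε = 1`
  -- and `ε = -1`.
  have hRR : ∀ i j, ∀ x ∈ E, (L j).reflection ((L i).reflection x) ∈ E := fun i j x hx => by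
    simpa [smul_smul, hε] using hR j _ (hR i x hx)
  have hchain : ∀ m, 3 ≤ m → m ≤ k → SaturatedAlong E (⨆ l : Fin k, ⨆ _ : (l : ℕ) < m, L l) := by
    intro m hm
    induction m, hm using Nat.le_induction with
    | base =>
      refine fun _ => (hL.triple.saturatedAlong hp hE (hRR _ _) (hRR _ _)).mono ?_
      refine iSup₂_le fun l hl => ?_
      obtain ⟨l, hlk⟩ := l
      simp only at hl
      interval_cases l
      · exact le_sup_left.trans le_sup_left
      · exact le_sup_right.trans le_sup_left
      · exact le_sup_right
    | succ m hm ih =>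
      intro hmk
      have hle : ∀ l : Fin k, (l : ℕ) < m → L l ≤ ⨆ l : Fin k, ⨆ _ : (l : ℕ) < m, L l :=
        fun l hl => le_iSup₂_of_le l hl le_rfl
      refine ((ih (by omega)).sup_of_reflection (L := L ⟨m, hmk⟩) hε (hR _) ?_
        (hL.inf_orthogonal ⟨m, hmk⟩ hm)).mono ?_
      · rw [hdim, ← hdim ⟨0, by omega⟩]
        refine Submodule.finrank_lt_finrank_of_lt ((hL.triple.lt_sup hp).trans_le ?_)
        exact sup_le (sup_le (hle _ (by simp; omega)) (hle _ (by simp; omega)))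
          (hle _ (by simp; omega))
      · refine iSup₂_le fun l hl => ?_
        rcases Nat.lt_succ_iff_lt_or_eq.1 hl with hl | hl
        · exact (hle l hl).trans le_sup_left
        · obtain rfl : l = ⟨m, hmk⟩ := Fin.ext hl
          exact le_sup_right
  refine (hchain k hk le_rfl).mono ?_
  rw [← hL.sum_eq_top]
  exact iSup_le fun l => le_iSup₂_of_le l l.isLt le_rfl

theorem mainTheorem3 (n i k : ℕ) (hk : 3 ≤ k)
    (H : Fin k → Submodule ℝ (EuclideanSpace ℝ (Fin n)))
    (hdim : ∀ j, Module.finrank ℝ (H j) = i)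
    (hH : (2 ≤ i ∧ 2 * i ≤ n ∧ ReflectionConditions hk i H) ∨
      (n < 2 * i ∧ i + 2 ≤ n ∧ ReflectionConditions hk (n - i) (fun j => (H j)ᗮ)))
    (E : Set (EuclideanSpace ℝ (Fin n)))
    (hE_sub : E ⊆ Metric.sphere (0 : EuclideanSpace ℝ (Fin n)) 1)
    (hE_ne : E.Nonempty) (hE_closed : IsClosed E)
    (hE_inv : ∀ j, (H j).reflection '' E = E) :
    E = Metric.sphere (0 : EuclideanSpace ℝ (Fin n)) 1 := by
  have hR : ∀ j, ∀ x ∈ E, (H j).reflection x ∈ E := fun j x hx =>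
    (hE_inv j).subset (Set.mem_image_of_mem _ hx)
  refine SaturatedAlong.eq_sphere ?_ hE_sub hE_ne
  rcases hH with ⟨hi, -, hH⟩ | ⟨-, hi, hH⟩
  · exact hH.saturatedAlong_top (by omega) hdim hE_closed (ε := 1) (by norm_num)
      fun j x hx => by simpa using hR j x hx
  -- The reflection in `(H j)ᗮ` is the negative of that in `H j`, so its negative preserves `E`.
  · refine hH.saturatedAlong_top (by omega) (fun j => ?_) hE_closed (ε := -1) (by norm_num)
      fun j x hx => by simpa [Submodule.reflection_orthogonal_apply] using hR j x hx
    have h1 := (H j).finrank_add_finrank_orthogonal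
    rw [hdim, finrank_euclideanSpace_fin] at h1
    omega
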